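/- **Model.** Let $\rho$ be a measure on $\mathbb{R}$ (the base measure), $G:\mathbb{R}\to\mathbb{R}$, and let $\gamma>0$ be such that $\int e^{xy}\,\rho(dy)=e^{G(x)}$ for all $x\in[-\gamma,\gamma]$. For $x\in[-\gamma,\gamma]$ let $\mathrm{Exp}_{\rho,G}(x)$ be the probability distribution on $\mathbb{R}$ with density $y\mapsto e^{xy-G(x)}$ with respect to $\rho$. Suppose that $G$ is twice differentiable on $[-\gamma,\gamma]$ (one-sidedly at the end points) and that $\bar\sigma_\gamma>0$ satisfies $G''(x)\le\bar\sigma_\gamma^2$ for all $x\in[-\gamma,\gamma]$. Let $\Pi$ be a probability distribution on $\{1,\dots,m_1\}\times\{1,\dots,m_2\}$. For a matrix $\bar X\in\mathbb{R}^{m_1\times m_2}$ with entries in $[-\gamma,\gamma]$, let $\mathbb{P}_{\bar X}$ be the law of the data $(\omega_i,Y_i)_{i=1}^n$, where the pairs $(\omega_i,Y_i)$ are i.i.d., $\omega_i\sim\Pi$, and, conditionally on $\omega_i=(k,l)$, $Y_i\sim\mathrm{Exp}_{\rho,G}(\bar X_{k,l})$. Put $M=\max(m_1,m_2)$ and $$\mathcal{F}(r,\gamma)=\{\bar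 X\in\mathbb{R}^{m_1\times m_2}:\ \operatorname{rank}(\bar X)\le r,\ \max_{k,l}|\bar X_{k,l}|\le\gamma\}.$$ **Theorem (minimax lower bound).** There exist absolute constants $c>0$ and $\theta>0$ such that, for all integers $m_1,m_2\ge2$, $1\le r\le\min(m_1,m_2)$, $n\ge1$, every $\gamma>0$, and all $\rho$, $G$, $\bar\sigma_\gamma$, $\Pi$ as above, $$\inf_{\hat X}\ \sup_{\bar X\in\mathcal{F}(r,\gamma)}\ \mathbb{P}_{\bar X}\left(\frac{\|\hat X-\bar X\|_F^2}{m_1m_2}>c\,\min\left\{\gamma^2,\ \frac{Mr}{n\,\bar\sigma_\gamma^2}\right\}\right)\ \ge\ \theta,$$ where the infimum is over all estimators $\hat X$, that is, all measurable functions of the data $(\omega_i,Y_i)_{i=1}^n$ with values in $\mathbb{R}^{m_1\times m_2}$, and $\|\cdot\|_F$ is the Frobenius norm. -/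

import Mathlib

open MeasureTheory
open scoped Matrix.Norms.Frobenius

/-- `G` is the log-partition function on `s` of the natural exponential family with base measure
`ρ` on `ℝ` (the measure `h(y) dy`, or `h(y)` times counting measure, in the usual notation):
`∫ exp (x * y) dρ(y) = exp (G x)` for `x ∈ s`. -/
def IsLogPartition (ρ : Measure ℝ) (G : ℝ → ℝ) (s : Set ℝ) : Prop :=
  ∀ x ∈ s, ∫⁻ y, ENNReal.ofReal (Real.exp (x * y)) ∂ρ = ENNReal.ofReal (Real.exp (G x))

/-- The law of the natural exponential family with parameter `x`: density `exp (x * y - G x)`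
with respect to the base measure `ρ`. -/
noncomputable def expFamily (ρ : Measure ℝ) (G : ℝ → ℝ) (x : ℝ) : Measure ℝ :=
  ρ.withDensity fun y => ENNReal.ofReal (Real.exp (x * y - G x))

/-- The law of one observation `(ω, Y)`: the index `ω` has distribution `p`, and given
`ω = (k, l)` the variable `Y` has the exponential family law with parameter `X k l`. -/
noncomputable def obsLaw {m₁ m₂ : ℕ} (ρ : Measure ℝ) (G : ℝ → ℝ) (p : PMF (Fin m₁ × Fin m₂))
    (X : Matrix (Fin m₁) (Fin m₂) ℝ) : Measure ((Fin m₁ × Fin m₂) × ℝ) :=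
  ∑ ω : Fin m₁ × Fin m₂, p ω • (expFamily ρ G (X ω.1 ω.2)).map (Prod.mk ω)

/-- The law of the data `(ω_i, Y_i)`, `i = 1, …, n`: independent copies of one observation. -/
noncomputable def dataLaw {m₁ m₂ : ℕ} (ρ : Measure ℝ) (G : ℝ → ℝ) (p : PMF (Fin m₁ × Fin m₂))
    (n : ℕ) (X : Matrix (Fin m₁) (Fin m₂) ℝ) : Measure (Fin n → (Fin m₁ × Fin m₂) × ℝ) :=
  Measure.pi fun _ => obsLaw ρ G p X

/-- Real `m₁ × m₂` matrices of rank at most `r` whose entries are bounded by `γ` in modulus. -/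
def lowRankBounded (m₁ m₂ r : ℕ) (γ : ℝ) : Set (Matrix (Fin m₁) (Fin m₂) ℝ) :=
  {X | X.rank ≤ r ∧ ∀ k l, |X k l| ≤ γ}

/-!
The lower bound is proved by Assouad's method with Hellinger affinities in place of
Kullback–Leibler divergences.

Put `M = max m₁ m₂` and `D = M * r`. Fold the shorter side of the matrix modulo `r`, so that each
cell carries one of `D` bits and each bit is carried by at least `m₁ * m₂ / (2 * D)` cells
(`exists_labelling`). A bit string `ε` gives the matrix with entries `± δ`, of rank at most `r`,
whose signs are read off from `ε` (`signMatrix`). The amplitude is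
`δ ^ 2 = min (γ ^ 2) (D / (2 * n * σ ^ 2))`.

Flipping the bit `j` changes the law of an observation only on the cells of `j`, which have some
mass `w j` under the index distribution. There the affinity of the two exponential family laws is
`exp (G 0 - (G δ + G (-δ)) / 2)` (`lintegral_sqrtDensity_mul`), which is at least
`1 - σ ^ 2 * δ ^ 2 / 2` because `σ ^ 2 * t ^ 2 / 2 - G t` is convex (`second_difference_le`). As
affinities are multiplicative over independent observations, Le Cam's inequality
(`sq_lintegral_mul_le_two_mul_add_compl`) and Bernoulli's inequality show that every test for the
bit `j` has total error at least `(1 - n * σ ^ 2 * δ ^ 2 * w j) / 2`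
(`le_dataLaw_real_add_compl`). No assumption on the index distribution is needed, because the
`w j` sum to `1` and hence these errors sum to at least `D / 4`.

By Assouad's lemma (`exists_half_sum_le_sum_measureReal_ne`), decoding any estimator bit by bit
makes at least `D / 8` errors on average for some `ε`. The number of errors is at most `D`, so it
exceeds `D / 16` with probability at least `1 / 16` (`sum_measureReal_ne_le`). Each wrong bit costs
`δ ^ 2` on each of its cells (`mul_card_ne_le_sum_sq_sub`), so on that event the normalized loss
exceeds `δ ^ 2 / 32`, which is at least `min (γ ^ 2) (D / (n * σ ^ 2)) / 64`.
-/

/-! ### Product measures -/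

theorem lintegral_pi_prod_eq_prod {α : Type*} [MeasurableSpace α] :
    ∀ {n : ℕ} (μ : Fin n → Measure α) [∀ i, SigmaFinite (μ i)] {f : α → ENNReal},
      Measurable f → ∫⁻ z, ∏ i, f (z i) ∂(Measure.pi μ) = ∏ i, ∫⁻ x, f x ∂(μ i)
  | 0, μ, _, f, hf => by simp
  | n + 1, μ, _, f, hf => by
    have hg : Measurable fun z : Fin n → α => ∏ i, f (z i) := by fun_prop
    rw [← ((measurePreserving_piFinSuccAbove μ 0).symm).lintegral_comp (by fun_prop)]
    simp_rw [MeasurableEquiv.piFinSuccAbove_symm_apply, Fin.insertNthEquiv,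
      Fin.prod_univ_succ, Fin.insertNth_zero]
    simp only [Fin.zero_succAbove, Equiv.coe_fn_mk, Fin.cons_zero, Fin.cons_succ, cast_eq]
    rw [lintegral_prod_mul hf.aemeasurable hg.aemeasurable, lintegral_pi_prod_eq_prod _ hf]

theorem pi_withDensity_eq {α : Type*} [MeasurableSpace α] {n : ℕ} (ν : Measure α) [SigmaFinite ν]
    {f : α → ENNReal} (hf : Measurable f) [SigmaFinite (ν.withDensity f)] :
    (Measure.pi fun _ : Fin n => ν.withDensity f) =
      (Measure.pi fun _ : Fin n => ν).withDensity fun z => ∏ i, f (z i) := by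
  symm
  refine (Measure.pi_eq fun s hs => ?_).symm
  rw [withDensity_apply _ (MeasurableSet.univ_pi hs), Measure.restrict_pi_pi,
    lintegral_pi_prod_eq_prod _ hf]
  exact Finset.prod_congr rfl fun i _ => (withDensity_apply _ (hs i)).symm

/-! ### Testing two hypotheses through the Hellinger affinity -/

/-- Le Cam's inequality: the Hellinger affinity `∫ u v dν` of two probability measures with
densities `u ^ 2` and `v ^ 2` bounds from below the total error of every test between them. -/
theorem sq_lintegral_mul_le_two_mul_add_compl {α : Type*} [MeasurableSpace α] {ν : Measure α}
    {u v : α → ENNReal} (hu : Measurable u) (hv : Measurable v)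
    [IsProbabilityMeasure (ν.withDensity fun x => u x ^ 2)]
    [IsProbabilityMeasure (ν.withDensity fun x => v x ^ 2)] {A : Set α} (hA : MeasurableSet A) :
    (∫⁻ x, u x * v x ∂ν) ^ 2 ≤
      2 * ((ν.withDensity fun x => u x ^ 2) A + (ν.withDensity fun x => v x ^ 2) Aᶜ) := by
  set P := ν.withDensity fun x => u x ^ 2
  set Q := ν.withDensity fun x => v x ^ 2
  have holder : ∀ {B : Set α}, MeasurableSet B →
      ∫⁻ x in B, u x * v x ∂ν ≤ P B ^ (1 / 2 : ℝ) * Q B ^ (1 / 2 : ℝ) := by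
    intro B hB
    have h := ENNReal.lintegral_mul_le_Lp_mul_Lq (ν.restrict B) Real.HolderConjugate.two_two
      hu.aemeasurable hv.aemeasurable
    simpa only [ENNReal.rpow_two, Pi.mul_apply, P, Q, withDensity_apply _ hB] using h
  have sq_half : ∀ a : ENNReal, (a ^ (1 / 2 : ℝ)) ^ 2 = a := by
    intro a
    rw [← ENNReal.rpow_natCast, ← ENNReal.rpow_mul]
    norm_num
  have le_one : ∀ (R : Measure α) [IsProbabilityMeasure R] (B : Set α),
      R B ^ (1 / 2 : ℝ) ≤ 1 := fun R _ B => ENNReal.rpow_le_one prob_le_one (by norm_num)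
  calc (∫⁻ x, u x * v x ∂ν) ^ 2
      = (∫⁻ x in A, u x * v x ∂ν + ∫⁻ x in Aᶜ, u x * v x ∂ν) ^ 2 := by
        rw [lintegral_add_compl _ hA]
    _ ≤ (P A ^ (1 / 2 : ℝ) + Q Aᶜ ^ (1 / 2 : ℝ)) ^ 2 := by
        gcongr
        · exact (holder hA).trans (mul_le_of_le_one_right' (le_one Q A))
        · exact (holder hA.compl).trans (mul_le_of_le_one_left' (le_one P Aᶜ))
    _ ≤ 2 * ((P A ^ (1 / 2 : ℝ)) ^ 2 + (Q Aᶜ ^ (1 / 2 : ℝ)) ^ 2) := by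
        have h := ENNReal.rpow_add_le_mul_rpow_add_rpow (P A ^ (1 / 2 : ℝ)) (Q Aᶜ ^ (1 / 2 : ℝ))
          (p := 2) one_le_two
        norm_num only [ENNReal.rpow_two, ENNReal.rpow_one] at h ⊢
        exact h
    _ = _ := by rw [sq_half, sq_half]

/-! ### Assouad's lemma -/

section Assouad

variable {J Z : Type*} [Fintype J] [MeasurableSpace Z]

/-- Assouad's lemma. If for each bit `j` every test between the hypotheses `ε` and `ε` with its
`j`-th bit flipped has total error at least `b j`, then any estimator `ψ` of `ε` makes at least
`(∑ j, b j) / 2` bit errors on average under some `ε`. -/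
theorem exists_half_sum_le_sum_measureReal_ne [DecidableEq J] (P : (J → Bool) → Measure Z)
    (ψ : Z → J → Bool) (hψ : ∀ j, Measurable fun z => ψ z j)
    (b : J → ℝ)
    (hb : ∀ ε j A, MeasurableSet A →
      b j ≤ (P ε).real A + (P (Function.update ε j (!ε j))).real Aᶜ) :
    ∃ ε, (∑ j, b j) / 2 ≤ ∑ j, (P ε).real {z | ψ z j ≠ ε j} := by
  let flip (j : J) : Equiv.Perm (J → Bool) :=
    Function.Involutive.toPerm (fun ε => Function.update ε j (!ε j)) fun ε => by
      simp
  have hbit : ∀ j, ∑ _ε : J → Bool, b j / 2 ≤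
      ∑ ε : J → Bool, (P ε).real {z | ψ z j ≠ ε j} := by
    intro j
    have h₁ : ∑ ε : J → Bool, (P (flip j ε)).real {z | ψ z j ≠ flip j ε j} =
        ∑ ε : J → Bool, (P ε).real {z | ψ z j ≠ ε j} :=
      Equiv.sum_comp (flip j) fun ε => (P ε).real {z | ψ z j ≠ ε j}
    have h₂ : ∑ _ε : J → Bool, b j ≤ ∑ ε : J → Bool,
        ((P ε).real {z | ψ z j ≠ ε j} + (P (flip j ε)).real {z | ψ z j ≠ flip j ε j}) := by
      refine Finset.sum_le_sum fun ε _ => ?_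
      have hflip : flip j ε = Function.update ε j (!ε j) := rfl
      have hcompl : {z | ψ z j ≠ flip j ε j} = {z | ψ z j ≠ ε j}ᶜ := by
        ext z
        simp [hflip]
      rw [hcompl, hflip]
      exact hb ε j _ (hψ j (MeasurableSet.of_discrete (s := {ε j}ᶜ)))
    rw [Finset.sum_add_distrib, h₁] at h₂
    rw [← Finset.sum_div]
    linarith
  obtain ⟨ε, -, hε⟩ := Finset.exists_le_of_sum_le (s := Finset.univ)
    (f := fun _ : J → Bool => (∑ j, b j) / 2)
    (g := fun ε => ∑ j, (P ε).real {z | ψ z j ≠ ε j}) Finset.univ_nonempty (by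
      rw [Finset.sum_comm (f := fun (ε : J → Bool) j => (P ε).real {z | ψ z j ≠ ε j})]
      simp_rw [Finset.sum_div]
      rw [Finset.sum_comm]
      exact Finset.sum_le_sum fun j _ => hbit j)
  exact ⟨ε, hε⟩

/-- The number of bit errors never exceeds the number of bits, so a large average number of
errors forces a large probability of many errors. -/
theorem sum_measureReal_ne_le (P : Measure Z) [IsProbabilityMeasure P]
    (ψ : Z → J → Bool) (hψ : ∀ j, Measurable fun z => ψ z j) (ε : J → Bool) {a : ℝ}
    (ha : 0 ≤ a) :
    ∑ j, P.real {z | ψ z j ≠ ε j} ≤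
      a + Fintype.card J * P.real {z | a < ((Finset.univ.filter fun j => ψ z j ≠ ε j).card : ℝ)} := by
  have hm : ∀ j, MeasurableSet {z | ψ z j ≠ ε j} := fun j =>
    hψ j (MeasurableSet.of_discrete (s := {ε j}ᶜ))
  have hcard : ∀ z, ((Finset.univ.filter fun j => ψ z j ≠ ε j).card : ℝ) =
      ∑ j, {z | ψ z j ≠ ε j}.indicator (fun _ => (1 : ℝ)) z := by
    intro z
    simp [Set.indicator_apply, Finset.sum_ite]
  have hint : ∀ j, Integrable ({z | ψ z j ≠ ε j}.indicator fun _ => (1 : ℝ)) P := fun j =>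
    (integrable_const _).indicator (hm j)
  set E := {z | a < ((Finset.univ.filter fun j => ψ z j ≠ ε j).card : ℝ)} with hE
  have hEm : MeasurableSet E := by
    simp_rw [hE, hcard]
    refine measurableSet_lt measurable_const (Finset.measurable_sum _ fun j _ => ?_)
    exact measurable_const.indicator (hm j)
  calc ∑ j, P.real {z | ψ z j ≠ ε j}
      = ∫ z, ∑ j, {z | ψ z j ≠ ε j}.indicator (fun _ => (1 : ℝ)) z ∂P := by
        rw [integral_finsetSum _ fun j _ => hint j]
        simp [integral_indicator_const, hm]
    _ ≤ ∫ z, (a + E.indicator (fun _ => (Fintype.card J : ℝ)) z) ∂P := by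
        refine integral_mono (integrable_finsetSum _ fun j _ => hint j)
          ((integrable_const _).add ((integrable_const _).indicator hEm)) fun z => ?_
        simp only [← hcard]
        by_cases hz : z ∈ E
        · rw [Set.indicator_of_mem hz]
          have : ((Finset.univ.filter fun j => ψ z j ≠ ε j).card : ℝ) ≤ Fintype.card J := by
            exact_mod_cast Finset.card_le_univ _
          linarith
        · rw [Set.indicator_of_notMem hz, add_zero]
          exact not_lt.1 hz
    _ = _ := by
        rw [integral_add (integrable_const _) ((integrable_const _).indicator hEm),
          integral_indicator_const _ hEm]
        simp [mul_comm]

end Assouad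

/-! ### The exponential family -/

section ExpFamily

variable {ρ : Measure ℝ} {G : ℝ → ℝ} {s : Set ℝ}

/-- The square root of the density `exp (x * y - G x)` of the exponential family. -/
noncomputable def sqrtDensity (G : ℝ → ℝ) (x y : ℝ) : ENNReal :=
  ENNReal.ofReal (Real.exp ((x * y - G x) / 2))

@[fun_prop]
theorem measurable_sqrtDensity (G : ℝ → ℝ) (x : ℝ) : Measurable (sqrtDensity G x) := by
  unfold sqrtDensity
  fun_prop

theorem sqrtDensity_sq (G : ℝ → ℝ) (x y : ℝ) :
    sqrtDensity G x y ^ 2 = ENNReal.ofReal (Real.exp (x * y - G x)) := by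
  rw [sqrtDensity, ← ENNReal.ofReal_pow (Real.exp_nonneg _), ← Real.exp_nat_mul]
  congr 2
  push_cast
  ring

/-- The Hellinger affinity inside an exponential family is explicit in the log-partition
function, because the geometric mean of two members is proportional to the member at the
midpoint. -/
theorem lintegral_sqrtDensity_mul (hG : IsLogPartition ρ G s) {x x' : ℝ}
    (hs : (x + x') / 2 ∈ s) :
    ∫⁻ y, sqrtDensity G x y * sqrtDensity G x' y ∂ρ =
      ENNReal.ofReal (Real.exp (G ((x + x') / 2) - (G x + G x') / 2)) := by
  have h : ∀ y, sqrtDensity G x y * sqrtDensity G x' y =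
      ENNReal.ofReal (Real.exp (-(G x + G x') / 2)) *
        ENNReal.ofReal (Real.exp ((x + x') / 2 * y)) := by
    intro y
    rw [sqrtDensity, sqrtDensity, ← ENNReal.ofReal_mul (Real.exp_nonneg _),
      ← ENNReal.ofReal_mul (Real.exp_nonneg _), ← Real.exp_add, ← Real.exp_add]
    congr 2
    ring
  simp_rw [h]
  rw [lintegral_const_mul _ (by fun_prop), hG _ hs, ← ENNReal.ofReal_mul (Real.exp_nonneg _),
    ← Real.exp_add]
  congr 2
  ring

theorem lintegral_sqrtDensity_mul_self (hG : IsLogPartition ρ G s) {x : ℝ} (hs : x ∈ s) :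
    ∫⁻ y, sqrtDensity G x y * sqrtDensity G x y ∂ρ = 1 := by
  rw [lintegral_sqrtDensity_mul hG (by simpa using hs)]
  simp

theorem IsLogPartition.isFiniteMeasure (hG : IsLogPartition ρ G s) (hs : 0 ∈ s) :
    IsFiniteMeasure ρ := by
  have h := hG 0 hs
  simp only [zero_mul, Real.exp_zero, ENNReal.ofReal_one, lintegral_one] at h
  exact ⟨h ▸ ENNReal.ofReal_lt_top⟩

/-- If `G'' ≤ σ ^ 2`, then `σ ^ 2 * t ^ 2 / 2 - G t` is convex; its midpoint inequality bounds
the second difference of `G` at `0`. -/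
theorem second_difference_le {G' G'' : ℝ → ℝ} {γ σ δ : ℝ} (hδ : 0 ≤ δ) (hδγ : δ ≤ γ)
    (hG' : ∀ x ∈ Set.Icc (-γ) γ, HasDerivWithinAt G (G' x) (Set.Icc (-γ) γ) x)
    (hG'' : ∀ x ∈ Set.Icc (-γ) γ, HasDerivWithinAt G' (G'' x) (Set.Icc (-γ) γ) x)
    (hσ : ∀ x ∈ Set.Icc (-γ) γ, G'' x ≤ σ ^ 2) :
    (G δ + G (-δ)) / 2 - G 0 ≤ σ ^ 2 * δ ^ 2 / 2 := by
  have hsub : interior (Set.Icc (-γ) γ) ⊆ Set.Icc (-γ) γ := interior_subset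
  have hconv : ConvexOn ℝ (Set.Icc (-γ) γ) fun t => σ ^ 2 / 2 * t ^ 2 - G t := by
    refine convexOn_of_hasDerivWithinAt2_nonneg (convex_Icc _ _)
      (f' := fun t => σ ^ 2 * t - G' t) (f'' := fun t => σ ^ 2 - G'' t) ?_ ?_ ?_ ?_
    · exact ContinuousOn.sub (by fun_prop) fun x hx => (hG' x hx).continuousWithinAt
    · intro x hx
      refine HasDerivWithinAt.sub ?_ ((hG' x (hsub hx)).mono hsub)
      convert ((hasDerivAt_pow 2 x).const_mul (σ ^ 2 / 2)).hasDerivWithinAt using 1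
      norm_num
      ring
    · intro x hx
      refine HasDerivWithinAt.sub ?_ ((hG'' x (hsub hx)).mono hsub)
      simpa using ((hasDerivAt_id x).const_mul (σ ^ 2)).hasDerivWithinAt
    · intro x hx
      linarith [hσ x (hsub hx)]
  have hpos : δ ∈ Set.Icc (-γ) γ := ⟨by linarith, hδγ⟩
  have hneg : -δ ∈ Set.Icc (-γ) γ := ⟨by linarith, by linarith⟩
  have half_nonneg : (0 : ℝ) ≤ 1 / 2 := by norm_num
  have h := hconv.2 hpos hneg half_nonneg half_nonneg (by norm_num)
  simp only [smul_eq_mul] at h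
  rw [show (1 / 2 : ℝ) * δ + 1 / 2 * -δ = 0 by ring] at h
  linarith

end ExpFamily

/-! ### The law of the data -/

section Data

variable {m₁ m₂ n : ℕ} {ρ : Measure ℝ} {G : ℝ → ℝ} {s : Set ℝ} {p : PMF (Fin m₁ × Fin m₂)}
  {X X' : Matrix (Fin m₁) (Fin m₂) ℝ}

/-- The product of the index distribution `p` and the base measure `ρ`: a common dominating measure
for all the laws `obsLaw ρ G p X`. -/
noncomputable def baseLaw (ρ : Measure ℝ) (p : PMF (Fin m₁ × Fin m₂)) :
    Measure ((Fin m₁ × Fin m₂) × ℝ) :=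
  ∑ ω, p ω • ρ.map (Prod.mk ω)

/-- The square root of the density of `obsLaw ρ G p X` with respect to `baseLaw ρ p`. -/
noncomputable def obsSqrtDensity (G : ℝ → ℝ) (X : Matrix (Fin m₁) (Fin m₂) ℝ)
    (z : (Fin m₁ × Fin m₂) × ℝ) : ENNReal :=
  sqrtDensity G (X z.1.1 z.1.2) z.2

@[fun_prop]
theorem measurable_obsSqrtDensity (G : ℝ → ℝ) (X : Matrix (Fin m₁) (Fin m₂) ℝ) :
    Measurable (obsSqrtDensity G X) :=
  measurable_from_prod_countable_right fun ω => measurable_sqrtDensity G (X ω.1 ω.2)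

theorem lintegral_baseLaw {f : (Fin m₁ × Fin m₂) × ℝ → ENNReal} (hf : Measurable f) :
    ∫⁻ z, f z ∂(baseLaw ρ p) = ∑ ω, p ω * ∫⁻ y, f (ω, y) ∂ρ := by
  rw [baseLaw, lintegral_finsetSum_measure]
  refine Finset.sum_congr rfl fun ω _ => ?_
  rw [lintegral_smul_measure, lintegral_map hf measurable_prodMk_left, smul_eq_mul]

instance [IsFiniteMeasure ρ] : IsFiniteMeasure (baseLaw ρ p) := by
  refine ⟨?_⟩
  rw [← lintegral_one, lintegral_baseLaw measurable_const]
  simp only [lintegral_one]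
  exact ENNReal.sum_lt_top.2 fun ω _ =>
    ENNReal.mul_lt_top (p.apply_lt_top ω) (measure_lt_top ρ _)

theorem obsLaw_eq_withDensity : obsLaw ρ G p X =
    (baseLaw ρ p).withDensity fun z => obsSqrtDensity G X z ^ 2 := by
  ext t ht
  rw [withDensity_apply _ ht, ← lintegral_indicator ht,
    lintegral_baseLaw (Measurable.indicator (by fun_prop) ht), obsLaw, Measure.finsetSum_apply]
  refine Finset.sum_congr rfl fun ω _ => ?_
  have htω : MeasurableSet (Prod.mk ω ⁻¹' t) := measurable_prodMk_left ht
  rw [Measure.smul_apply, Measure.map_apply measurable_prodMk_left ht, expFamily,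
    withDensity_apply _ htω, ← lintegral_indicator htω, smul_eq_mul]
  congr 2 with y
  simp only [obsSqrtDensity, sqrtDensity_sq]
  rfl

theorem sum_pmf_toReal : ∑ ω, (p ω).toReal = 1 := by
  rw [← ENNReal.toReal_sum fun ω _ => p.apply_ne_top ω, ← tsum_fintype (L := .unconditional _),
    p.tsum_coe, ENNReal.toReal_one]

theorem isProbabilityMeasure_obsLaw (hG : IsLogPartition ρ G s) (hX : ∀ k l, X k l ∈ s) :
    IsProbabilityMeasure (obsLaw ρ G p X) := by
  refine ⟨?_⟩
  rw [obsLaw_eq_withDensity, withDensity_apply _ .univ, Measure.restrict_univ,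
    lintegral_baseLaw (by fun_prop)]
  simp_rw [obsSqrtDensity, sq, lintegral_sqrtDensity_mul_self hG (hX _ _), mul_one]
  rw [← tsum_fintype (L := .unconditional _), p.tsum_coe]

theorem isProbabilityMeasure_dataLaw (hG : IsLogPartition ρ G s) (hX : ∀ k l, X k l ∈ s) :
    IsProbabilityMeasure (dataLaw ρ G p n X) := by
  have := isProbabilityMeasure_obsLaw (p := p) hG hX
  unfold dataLaw
  infer_instance

theorem dataLaw_eq_withDensity [IsFiniteMeasure ρ] (hG : IsLogPartition ρ G s)
    (hX : ∀ k l, X k l ∈ s) : dataLaw ρ G p n X =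
      (Measure.pi fun _ => baseLaw ρ p).withDensity
        fun z => (∏ i, obsSqrtDensity G X (z i)) ^ 2 := by
  have := isProbabilityMeasure_obsLaw (p := p) hG hX
  rw [obsLaw_eq_withDensity] at this
  simp_rw [dataLaw, obsLaw_eq_withDensity, ← Finset.prod_pow]
  exact pi_withDensity_eq (baseLaw ρ p) (f := fun z => obsSqrtDensity G X z ^ 2) (by fun_prop)

/-- Bernoulli's inequality, with the base truncated at `0`. -/
theorem ofReal_one_sub_mul_le_pow (a : ℝ) (N : ℕ) :
    ENNReal.ofReal (1 - N * a) ≤ ENNReal.ofReal (1 - a) ^ N := by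
  rcases Nat.eq_zero_or_pos N with rfl | hN
  · simp
  rcases le_total a 1 with h | h
  · rw [← ENNReal.ofReal_pow (by linarith)]
    refine ENNReal.ofReal_le_ofReal ?_
    have := one_add_mul_le_pow (a := -a) (by linarith) N
    rw [← sub_eq_add_neg] at this
    linarith
  · have : (1 : ℝ) ≤ N := by exact_mod_cast hN
    rw [ENNReal.ofReal_of_nonpos (by nlinarith)]
    exact zero_le

/-- Two parameter matrices that differ only by the sign of the entries in `S`, all of modulus `δ`
there, cannot be told apart when the expected number `n * p(S)` of observations in `S` is
small compared with `1 / (σ * δ) ^ 2`. -/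
theorem le_dataLaw_real_add_compl {G' G'' : ℝ → ℝ} {γ σ δ : ℝ} (hδ : 0 ≤ δ) (hδγ : δ ≤ γ)
    (hG : IsLogPartition ρ G (Set.Icc (-γ) γ))
    (hG' : ∀ x ∈ Set.Icc (-γ) γ, HasDerivWithinAt G (G' x) (Set.Icc (-γ) γ) x)
    (hG'' : ∀ x ∈ Set.Icc (-γ) γ, HasDerivWithinAt G' (G'' x) (Set.Icc (-γ) γ) x)
    (hσ : ∀ x ∈ Set.Icc (-γ) γ, G'' x ≤ σ ^ 2)
    (hX : ∀ k l, X k l ∈ Set.Icc (-γ) γ) (hX' : ∀ k l, X' k l ∈ Set.Icc (-γ) γ)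
    {S : Finset (Fin m₁ × Fin m₂)} (heq : ∀ ω ∉ S, X' ω.1 ω.2 = X ω.1 ω.2)
    (hneg : ∀ ω ∈ S, X' ω.1 ω.2 = -X ω.1 ω.2) (habs : ∀ ω ∈ S, |X ω.1 ω.2| = δ)
    {A : Set (Fin n → (Fin m₁ × Fin m₂) × ℝ)} (hA : MeasurableSet A) :
    (1 - n * (σ ^ 2 * δ ^ 2) * ∑ ω ∈ S, (p ω).toReal) / 2 ≤
      (dataLaw ρ G p n X).real A + (dataLaw ρ G p n X').real Aᶜ := by
  have h0 : (0 : ℝ) ∈ Set.Icc (-γ) γ := ⟨by linarith, by linarith⟩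
  have : IsFiniteMeasure ρ := hG.isFiniteMeasure h0
  have hP := isProbabilityMeasure_dataLaw (p := p) (n := n) hG hX
  have hQ := isProbabilityMeasure_dataLaw (p := p) (n := n) hG hX'
  set κ := (G δ + G (-δ)) / 2 - G 0 with hκ
  have hκle : κ ≤ σ ^ 2 * δ ^ 2 / 2 := second_difference_le hδ hδγ hG' hG'' hσ
  have hcell : ∀ ω : Fin m₁ × Fin m₂,
      ∫⁻ y, sqrtDensity G (X ω.1 ω.2) y * sqrtDensity G (X' ω.1 ω.2) y ∂ρ =
        ENNReal.ofReal (if ω ∈ S then Real.exp (-κ) else 1) := by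
    intro ω
    split_ifs with hω
    · rw [hneg ω hω, lintegral_sqrtDensity_mul hG (by simpa using h0), add_neg_cancel, zero_div]
      congr 2
      rcases abs_eq hδ |>.1 (habs ω hω) with h | h <;> rw [h, hκ]
      · ring
      · rw [neg_neg]
        ring
    · rw [heq ω hω, lintegral_sqrtDensity_mul_self hG (hX _ _), ENNReal.ofReal_one]
  set w := ∑ ω ∈ S, (p ω).toReal with hw
  have hobs : ENNReal.ofReal (1 - σ ^ 2 * δ ^ 2 / 2 * w) ≤
      ∫⁻ z, obsSqrtDensity G X z * obsSqrtDensity G X' z ∂(baseLaw ρ p) := by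
    have hnonneg : ∀ ω : Fin m₁ × Fin m₂, 0 ≤ if ω ∈ S then Real.exp (-κ) else 1 := by
      intro ω
      split_ifs <;> positivity
    have hsum : ∫⁻ z, obsSqrtDensity G X z * obsSqrtDensity G X' z ∂(baseLaw ρ p) =
        ENNReal.ofReal (∑ ω, (p ω).toReal * if ω ∈ S then Real.exp (-κ) else 1) := by
      rw [lintegral_baseLaw (by fun_prop), ENNReal.ofReal_sum_of_nonneg fun ω _ =>
        mul_nonneg ENNReal.toReal_nonneg (hnonneg ω)]
      refine Finset.sum_congr rfl fun ω _ => ?_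
      rw [ENNReal.ofReal_mul ENNReal.toReal_nonneg, ENNReal.ofReal_toReal (p.apply_ne_top ω),
        ← hcell ω]
      rfl
    rw [hsum]
    refine ENNReal.ofReal_le_ofReal ?_
    calc 1 - σ ^ 2 * δ ^ 2 / 2 * w
        = ∑ ω, (p ω).toReal * (1 - if ω ∈ S then σ ^ 2 * δ ^ 2 / 2 else 0) := by
          simp_rw [mul_sub, mul_one, Finset.sum_sub_distrib, mul_ite, mul_zero,
            Finset.sum_ite_mem, Finset.univ_inter, ← Finset.sum_mul, sum_pmf_toReal, hw]
          ring
      _ ≤ _ := by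
          refine Finset.sum_le_sum fun ω _ => mul_le_mul_of_nonneg_left ?_ ENNReal.toReal_nonneg
          split_ifs
          · linarith [Real.add_one_le_exp (-κ)]
          · simp
  have haff : ∫⁻ z, (∏ i, obsSqrtDensity G X (z i)) * ∏ i, obsSqrtDensity G X' (z i)
        ∂(Measure.pi fun _ : Fin n => baseLaw ρ p) =
      (∫⁻ z, obsSqrtDensity G X z * obsSqrtDensity G X' z ∂(baseLaw ρ p)) ^ n := by
    simp_rw [← Finset.prod_mul_distrib]
    rw [lintegral_pi_prod_eq_prod _ (f := fun z => obsSqrtDensity G X z * obsSqrtDensity G X' z)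
      (by fun_prop)]
    simp
  have hlecam : (∫⁻ z, (∏ i, obsSqrtDensity G X (z i)) * ∏ i, obsSqrtDensity G X' (z i)
        ∂(Measure.pi fun _ : Fin n => baseLaw ρ p)) ^ 2 ≤
      2 * (dataLaw ρ G p n X A + dataLaw ρ G p n X' Aᶜ) := by
    rw [dataLaw_eq_withDensity hG hX] at hP ⊢
    rw [dataLaw_eq_withDensity hG hX'] at hQ ⊢
    exact sq_lintegral_mul_le_two_mul_add_compl (by fun_prop) (by fun_prop) hA
  have hmain : ENNReal.ofReal (1 - n * (σ ^ 2 * δ ^ 2) * w) ≤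
      2 * (dataLaw ρ G p n X A + dataLaw ρ G p n X' Aᶜ) := by
    refine le_trans ?_ hlecam
    rw [haff, ← pow_mul]
    refine le_trans ?_ (pow_le_pow_left' hobs _)
    have h := ofReal_one_sub_mul_le_pow (σ ^ 2 * δ ^ 2 / 2 * w) (n * 2)
    rwa [show ((n * 2 : ℕ) : ℝ) * (σ ^ 2 * δ ^ 2 / 2 * w) = n * (σ ^ 2 * δ ^ 2) * w by
      push_cast; ring] at h
  have hfin : 2 * (dataLaw ρ G p n X A + dataLaw ρ G p n X' Aᶜ) ≠ ⊤ := by finiteness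
  have := (ENNReal.ofReal_le_iff_le_toReal hfin).1 hmain
  rw [ENNReal.toReal_mul, ENNReal.toReal_add (measure_ne_top _ _) (measure_ne_top _ _)] at this
  simp only [ENNReal.toReal_ofNat] at this
  simp only [Measure.real]
  linarith

end Data

/-! ### Sign patterns and their decoding -/

/-- The sign coded by a bit: `true` is `1` and `false` is `-1`. -/
def bitSign (b : Bool) : ℝ := if b then 1 else -1

theorem bitSign_not (b : Bool) : bitSign (!b) = -bitSign b := by
  cases b <;> simp [bitSign]

theorem abs_bitSign (b : Bool) : |bitSign b| = 1 := by
  cases b <;> simp [bitSign]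

section Decoding

variable {ι J : Type*} [Fintype ι] [Fintype J] [DecidableEq J]

/-- Decode each bit by the sign of the sum of `x` over the cells that carry it. A wrong bit costs at
least `δ ^ 2` per cell carrying it, by the Cauchy–Schwarz inequality over these cells. -/
theorem mul_card_ne_le_sum_sq_sub (φ : ι → J) {δ N : ℝ} (hδ : 0 ≤ δ)
    (hN : ∀ j, N ≤ ((Finset.univ.filter fun i => φ i = j).card : ℝ)) (x : ι → ℝ) (ε : J → Bool) :
    δ ^ 2 * N * ((Finset.univ.filter fun j =>
        decide (0 ≤ ∑ i with φ i = j, x i) ≠ ε j).card : ℝ) ≤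
      ∑ i, (x i - δ * bitSign (ε (φ i))) ^ 2 := by
  have hbit : ∀ j, decide (0 ≤ ∑ i with φ i = j, x i) ≠ ε j →
      δ ^ 2 * N ≤ ∑ i with φ i = j, (x i - δ * bitSign (ε (φ i))) ^ 2 := by
    intro j hj
    set F := Finset.univ.filter fun i => φ i = j with hF
    have hcongr : ∑ i ∈ F, (x i - δ * bitSign (ε (φ i))) ^ 2 =
        ∑ i ∈ F, (x i - δ * bitSign (ε j)) ^ 2 :=
      Finset.sum_congr rfl fun i hi => by rw [(Finset.mem_filter.1 hi).2]
    have hcs := sq_sum_le_card_mul_sum_sq (s := F) (f := fun i => x i - δ * bitSign (ε j))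
    rw [Finset.sum_sub_distrib, Finset.sum_const, nsmul_eq_mul] at hcs
    have hwrong : (F.card * δ) ^ 2 ≤ (∑ i ∈ F, x i - F.card * (δ * bitSign (ε j))) ^ 2 := by
      have hFδ : 0 ≤ (F.card : ℝ) * δ := by positivity
      cases hε : ε j
      · have : 0 ≤ ∑ i ∈ F, x i := by simpa [hε] using hj
        simp only [bitSign, Bool.false_eq_true, if_false]
        nlinarith
      · have : ∑ i ∈ F, x i < 0 := by simpa [hε] using hj
        simp only [bitSign, if_true]
        nlinarith
    rw [hcongr]
    set Q := ∑ i ∈ F, (x i - δ * bitSign (ε j)) ^ 2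
    have hQ : 0 ≤ Q := Finset.sum_nonneg fun i _ => sq_nonneg _
    refine (mul_le_mul_of_nonneg_left (hN j) (sq_nonneg δ)).trans ?_
    rcases Nat.eq_zero_or_pos F.card with h | h
    · rw [h, Nat.cast_zero, mul_zero]
      exact hQ
    · have h' : (0 : ℝ) < F.card := by exact_mod_cast h
      refine le_of_mul_le_mul_left ?_ h'
      linarith [hwrong.trans hcs, mul_pow (F.card : ℝ) δ 2]
  calc δ ^ 2 * N * _
      = ∑ j with decide (0 ≤ ∑ i with φ i = j, x i) ≠ ε j, δ ^ 2 * N := by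
        rw [Finset.sum_const, nsmul_eq_mul, mul_comm]
    _ ≤ ∑ j with decide (0 ≤ ∑ i with φ i = j, x i) ≠ ε j,
          ∑ i with φ i = j, (x i - δ * bitSign (ε (φ i))) ^ 2 :=
        Finset.sum_le_sum fun j hj => hbit j (Finset.mem_filter.1 hj).2
    _ ≤ ∑ j, ∑ i with φ i = j, (x i - δ * bitSign (ε (φ i))) ^ 2 :=
        Finset.sum_le_sum_of_subset_of_nonneg (Finset.filter_subset _ _) fun j _ _ =>
          Finset.sum_nonneg fun i _ => sq_nonneg _
    _ = _ := Finset.sum_fiberwise _ _ _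

end Decoding

theorem frobenius_norm_sq {m₁ m₂ : ℕ} (A : Matrix (Fin m₁) (Fin m₂) ℝ) :
    ‖A‖ ^ 2 = ∑ ω : Fin m₁ × Fin m₂, A ω.1 ω.2 ^ 2 := by
  rw [Matrix.frobenius_norm_def, ← Real.sqrt_eq_rpow, Real.sq_sqrt (by positivity),
    Fintype.sum_prod_type]
  simp

/-! ### The lower bound over a family of sign patterns -/

/-- The matrix all of whose entries are `δ` up to a sign, the sign at the cell `ω` being given by
the bit of `ε` with label `φ ω`. -/
def signMatrix {m₁ m₂ : ℕ} {J : Type*} (φ : Fin m₁ × Fin m₂ → J) (δ : ℝ) (ε : J → Bool) :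
    Matrix (Fin m₁) (Fin m₂) ℝ :=
  Matrix.of fun k l => δ * bitSign (ε (φ (k, l)))

theorem abs_signMatrix {m₁ m₂ : ℕ} {J : Type*} (φ : Fin m₁ × Fin m₂ → J) {δ : ℝ} (hδ : 0 ≤ δ)
    (ε : J → Bool) (k : Fin m₁) (l : Fin m₂) : |signMatrix φ δ ε k l| = δ := by
  rw [signMatrix, Matrix.of_apply, abs_mul, abs_bitSign, mul_one, abs_of_nonneg hδ]

/-- For any labelling `φ` of the cells by bits in which every bit is carried by at least half the
average number of cells, some sign pattern is hard to estimate. The index distribution `p` is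
arbitrary: it enters only through the total mass `1` of the cells, summed over the bits. -/
theorem exists_signMatrix_lowerBound {m₁ m₂ n : ℕ} {J : Type*} [Fintype J] [Nonempty J]
    {γ σ δ : ℝ} {ρ : Measure ℝ} {G G' G'' : ℝ → ℝ} {p : PMF (Fin m₁ × Fin m₂)}
    (hm₁ : 0 < m₁) (hm₂ : 0 < m₂) (hδ : 0 < δ) (hδγ : δ ≤ γ)
    (hG : IsLogPartition ρ G (Set.Icc (-γ) γ))
    (hG' : ∀ x ∈ Set.Icc (-γ) γ, HasDerivWithinAt G (G' x) (Set.Icc (-γ) γ) x)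
    (hG'' : ∀ x ∈ Set.Icc (-γ) γ, HasDerivWithinAt G' (G'' x) (Set.Icc (-γ) γ) x)
    (hσ : ∀ x ∈ Set.Icc (-γ) γ, G'' x ≤ σ ^ 2)
    (hn : n * (σ ^ 2 * δ ^ 2) ≤ Fintype.card J / 2) [DecidableEq J]
    (φ : Fin m₁ × Fin m₂ → J)
    (hφ : ∀ j, m₁ * m₂ ≤ 2 * Fintype.card J * (Finset.univ.filter fun ω => φ ω = j).card)
    (Xhat : (Fin n → (Fin m₁ × Fin m₂) × ℝ) → Matrix (Fin m₁) (Fin m₂) ℝ)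
    (hXhat : ∀ k l, Measurable fun z => Xhat z k l) :
    ∃ ε : J → Bool, ENNReal.ofReal (1 / 16) ≤ dataLaw ρ G p n (signMatrix φ δ ε)
      {z | δ ^ 2 / 32 < ‖Xhat z - signMatrix φ δ ε‖ ^ 2 / ((m₁ : ℝ) * (m₂ : ℝ))} := by
  have hmem : ∀ ε k l, signMatrix φ δ ε k l ∈ Set.Icc (-γ) γ := fun ε k l =>
    abs_le.1 ((abs_signMatrix φ hδ.le ε k l).trans_le hδγ)
  let ψ : (Fin n → (Fin m₁ × Fin m₂) × ℝ) → J → Bool := fun z j =>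
    decide (0 ≤ ∑ ω with φ ω = j, Xhat z ω.1 ω.2)
  have hψ : ∀ j, Measurable fun z => ψ z j := fun j =>
    measurable_to_bool (by
      simpa [ψ, Set.preimage] using measurableSet_le measurable_const
        (Finset.measurable_sum _ fun ω _ => hXhat ω.1 ω.2))
  set D : ℝ := ((Fintype.card J : ℕ) : ℝ) with hD
  have hD0 : 0 < D := by
    rw [hD]
    exact_mod_cast Fintype.card_pos
  obtain ⟨ε, hε⟩ := exists_half_sum_le_sum_measureReal_ne
    (fun ε => dataLaw ρ G p n (signMatrix φ δ ε)) ψ hψ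
    (fun j => (1 - n * (σ ^ 2 * δ ^ 2) * ∑ ω with φ ω = j, (p ω).toReal) / 2) (by
      intro ε j A hA
      refine le_dataLaw_real_add_compl hδ.le hδγ hG hG' hG'' hσ (hmem _) (hmem _) ?_ ?_ ?_ hA
      · intro ω hω
        have : φ ω ≠ j := by simpa using hω
        simp [signMatrix, Function.update_of_ne this]
      · intro ω hω
        have : φ ω = j := by simpa using hω
        simp [signMatrix, this, bitSign_not]
      · exact fun ω _ => abs_signMatrix φ hδ.le ε ω.1 ω.2)
  refine ⟨ε, ?_⟩
  have hprob : IsProbabilityMeasure (dataLaw ρ G p n (signMatrix φ δ ε)) :=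
    isProbabilityMeasure_dataLaw hG (hmem ε)
  -- The cells of distinct bits are disjoint, so their masses under `p` add up to `1`.
  have hsum : ∑ j, (1 - n * (σ ^ 2 * δ ^ 2) * ∑ ω with φ ω = j, (p ω).toReal) / 2 =
      (D - n * (σ ^ 2 * δ ^ 2)) / 2 := by
    rw [← Finset.sum_div, Finset.sum_sub_distrib, ← Finset.mul_sum, Finset.sum_fiberwise,
      sum_pmf_toReal]
    simp [hD]
  have hmany := hε.trans (sum_measureReal_ne_le (dataLaw ρ G p n (signMatrix φ δ ε)) ψ hψ ε
    (a := D / 16) (by positivity))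
  rw [hsum] at hmany
  -- On average at least `D / 8` of the `D` bits are wrong, so with probability at least `1 / 16`
  -- more than `D / 16` of them are.
  have hevent : (1 : ℝ) / 16 ≤ (dataLaw ρ G p n (signMatrix φ δ ε)).real
      {z | D / 16 < ((Finset.univ.filter fun j => ψ z j ≠ ε j).card : ℝ)} := by
    refine le_of_mul_le_mul_left ?_ hD0
    linarith
  rw [ENNReal.ofReal_le_iff_le_toReal (measure_ne_top _ _)]
  refine hevent.trans (measureReal_mono fun z hz => ?_)
  have hmm : (0 : ℝ) < m₁ * m₂ := by positivity
  have hloss := mul_card_ne_le_sum_sq_sub φ (N := m₁ * m₂ / (2 * D)) hδ.le (fun j => by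
    rw [div_le_iff₀' (by positivity)]
    rw [hD]
    exact_mod_cast hφ j) (fun ω => Xhat z ω.1 ω.2) ε
  change D / 16 < ((Finset.univ.filter fun j => ψ z j ≠ ε j).card : ℝ) at hz
  change δ ^ 2 / 32 < _
  rw [lt_div_iff₀ hmm, frobenius_norm_sq]
  refine lt_of_lt_of_le ?_ hloss
  calc δ ^ 2 / 32 * (m₁ * m₂) = δ ^ 2 * (m₁ * m₂ / (2 * D)) * (D / 16) := by
        field_simp
        norm_num
    _ < _ := mul_lt_mul_of_pos_left hz (by positivity)

/-! ### Labellings of low rank -/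

/-- The residues modulo `r` of `0, …, m - 1`. -/
def residue {r : ℕ} (hr : 0 < r) {m : ℕ} (l : Fin m) : Fin r := ⟨l % r, Nat.mod_lt _ hr⟩

theorem le_two_mul_card_residue {r m : ℕ} (hr : 0 < r) (hrm : r ≤ m) (b : Fin r) :
    m ≤ 2 * r * (Finset.univ.filter fun l : Fin m => residue hr l = b).card := by
  have hdiv : r * (m / r) + m % r = m := Nat.div_add_mod m r
  have hmod : m % r < r := Nat.mod_lt _ hr
  have hpos : 1 ≤ m / r := Nat.div_pos hrm hr
  have hcard : m / r ≤ (Finset.univ.filter fun l : Fin m => residue hr l = b).card := by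
    have hlt : ∀ q : Fin (m / r), r * q + b < m := fun q => by
      have := Nat.mul_le_mul_left r (Nat.succ_le_of_lt q.2)
      rw [Nat.mul_succ] at this
      omega
    rw [← Fintype.card_fin (m / r), ← Finset.card_univ]
    refine Finset.card_le_card_of_injOn (fun q => ⟨r * q + b, hlt q⟩) (fun q _ => ?_) ?_
    · simp [residue, Fin.ext_iff, Nat.mod_eq_of_lt b.2]
    · intro q _ q' _ h
      have h' : r * (q : ℕ) + b = r * (q' : ℕ) + b := congrArg Fin.val h
      exact Fin.ext (Nat.eq_of_mul_eq_mul_left hr (by omega))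
  nlinarith

theorem rank_of_comp_residue_le {r m₁ m₂ : ℕ} (hr : 0 < r) (A : Matrix (Fin m₁) (Fin r) ℝ) :
    (Matrix.of fun k (l : Fin m₂) => A k (residue hr l)).rank ≤ r := by
  have h : (Matrix.of fun k (l : Fin m₂) => A k (residue hr l)) =
      A * Matrix.of fun b l => if b = residue hr l then (1 : ℝ) else 0 := by
    ext k l
    simp [Matrix.mul_apply]
  rw [h]
  exact (Matrix.rank_mul_le_left _ _).trans ((Matrix.rank_le_card_width A).trans_eq (by simp))

/-- There are `max m₁ m₂ * r` free signs: the longer side of the matrix is kept and the shorter one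
is folded modulo `r`. -/
theorem exists_labelling {m₁ m₂ r : ℕ} (hr : 0 < r) (hrm : r ≤ min m₁ m₂) :
    ∃ φ : Fin m₁ × Fin m₂ → Fin (max m₁ m₂) × Fin r,
      (∀ j, m₁ * m₂ ≤ 2 * Fintype.card (Fin (max m₁ m₂) × Fin r) *
        (Finset.univ.filter fun ω => φ ω = j).card) ∧
      ∀ δ ε, (signMatrix φ δ ε).rank ≤ r := by
  have hr₁ : r ≤ m₁ := hrm.trans (min_le_left _ _)
  have hr₂ : r ≤ m₂ := hrm.trans (min_le_right _ _)
  rcases le_total m₂ m₁ with h | h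
  · rw [max_eq_left h]
    refine ⟨fun ω => (ω.1, residue hr ω.2), fun j => ?_, fun δ ε => ?_⟩
    · have hf : (Finset.univ.filter fun ω : Fin m₁ × Fin m₂ => (ω.1, residue hr ω.2) = j) =
          {j.1} ×ˢ Finset.univ.filter fun l => residue hr l = j.2 := by
        ext ω
        simp [Prod.ext_iff, and_comm, eq_comm]
      rw [hf, Finset.card_product, Finset.card_singleton, one_mul, Fintype.card_prod,
        Fintype.card_fin, Fintype.card_fin]
      have := Nat.mul_le_mul_left m₁ (le_two_mul_card_residue hr hr₂ j.2)
      linarith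
    · exact rank_of_comp_residue_le hr (Matrix.of fun k b => δ * bitSign (ε (k, b)))
  · rw [max_eq_right h]
    refine ⟨fun ω => (ω.2, residue hr ω.1), fun j => ?_, fun δ ε => ?_⟩
    · have hf : (Finset.univ.filter fun ω : Fin m₁ × Fin m₂ => (ω.2, residue hr ω.1) = j) =
          (Finset.univ.filter fun k => residue hr k = j.2) ×ˢ {j.1} := by
        ext ω
        simp [Prod.ext_iff, and_comm, eq_comm]
      rw [hf, Finset.card_product, Finset.card_singleton, mul_one, Fintype.card_prod,
        Fintype.card_fin, Fintype.card_fin]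
      have := Nat.mul_le_mul_left m₂ (le_two_mul_card_residue hr hr₁ j.2)
      linarith
    · rw [← Matrix.rank_transpose]
      exact rank_of_comp_residue_le hr (Matrix.of fun l b => δ * bitSign (ε (l, b)))

/-! ### The minimax rate over bounded low-rank matrices -/

theorem mainTheorem2 :
    ∃ c θ : ℝ, 0 < c ∧ 0 < θ ∧
      ∀ (m₁ m₂ r n : ℕ) (γ σ : ℝ) (ρ : Measure ℝ) (G G' G'' : ℝ → ℝ)
        (p : PMF (Fin m₁ × Fin m₂)),
        2 ≤ m₁ → 2 ≤ m₂ → 1 ≤ r → r ≤ min m₁ m₂ → 1 ≤ n → 0 < γ → 0 < σ →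
        IsLogPartition ρ G (Set.Icc (-γ) γ) →
        (∀ x ∈ Set.Icc (-γ) γ, HasDerivWithinAt G (G' x) (Set.Icc (-γ) γ) x) →
        (∀ x ∈ Set.Icc (-γ) γ, HasDerivWithinAt G' (G'' x) (Set.Icc (-γ) γ) x) →
        (∀ x ∈ Set.Icc (-γ) γ, G'' x ≤ σ ^ 2) →
        ENNReal.ofReal θ ≤
          ⨅ (Xhat : (Fin n → (Fin m₁ × Fin m₂) × ℝ) → Matrix (Fin m₁) (Fin m₂) ℝ)
            (_ : ∀ k l, Measurable fun z => Xhat z k l),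
            ⨆ X ∈ lowRankBounded m₁ m₂ r γ,
              dataLaw ρ G p n X
                {z | c * min (γ ^ 2) (((max m₁ m₂ : ℕ) : ℝ) * (r : ℝ) / ((n : ℝ) * σ ^ 2)) <
                  ‖Xhat z - X‖ ^ 2 / ((m₁ : ℝ) * (m₂ : ℝ))} := by
  refine ⟨1 / 64, 1 / 16, by norm_num, by norm_num, ?_⟩
  intro m₁ m₂ r n γ σ ρ G G' G'' p hm₁ hm₂ hr hrm hn hγ hσ hG hG' hG'' hσ'
  refine le_iInf₂ fun Xhat hXhat => ?_
  obtain ⟨φ, hφ, hrank⟩ := exists_labelling hr hrm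
  have : Nonempty (Fin (max m₁ m₂) × Fin r) :=
    ⟨⟨0, lt_max_of_lt_left (by omega)⟩, ⟨0, hr⟩⟩
  have hM : (0 : ℝ) < (max m₁ m₂ : ℕ) := by
    exact_mod_cast lt_max_of_lt_left (show 0 < m₁ by omega)
  have hr0 : (0 : ℝ) < r := by exact_mod_cast hr
  have hn0 : (0 : ℝ) < n := by exact_mod_cast hn
  set T : ℝ := ((max m₁ m₂ : ℕ) : ℝ) * r / (n * σ ^ 2) with hT
  have hT0 : 0 < T := by positivity
  -- The largest amplitude for which the entries stay in `[-γ, γ]` and half of the total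
  -- information budget is left.
  set δ := Real.sqrt (min (γ ^ 2) (T / 2)) with hδ
  have hpos : 0 < min (γ ^ 2) (T / 2) := lt_min (by positivity) (by positivity)
  have hδ0 : 0 < δ := Real.sqrt_pos.2 hpos
  have hδsq : δ ^ 2 = min (γ ^ 2) (T / 2) := Real.sq_sqrt hpos.le
  have hδγ : δ ≤ γ := Real.sqrt_le_iff.2 ⟨hγ.le, min_le_left _ _⟩
  have hbudget : n * (σ ^ 2 * δ ^ 2) ≤ (Fintype.card (Fin (max m₁ m₂) × Fin r) : ℝ) / 2 := by
    calc n * (σ ^ 2 * δ ^ 2) ≤ n * (σ ^ 2 * (T / 2)) := by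
          rw [hδsq]
          gcongr
          exact min_le_right _ _
      _ = _ := by
          rw [hT, Fintype.card_prod, Fintype.card_fin, Fintype.card_fin]
          push_cast
          field_simp
  obtain ⟨ε, hε⟩ := exists_signMatrix_lowerBound (p := p) (by omega) (by omega) hδ0 hδγ hG hG'
    hG'' hσ' hbudget φ hφ Xhat hXhat
  refine hε.trans (le_iSup₂_of_le (signMatrix φ δ ε)
    ⟨hrank δ ε, fun k l => (abs_signMatrix φ hδ0.le ε k l).trans_le hδγ⟩
    (measure_mono fun z hz => ?_))
  change δ ^ 2 / 32 < _ at hz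
  refine lt_of_le_of_lt (b := δ ^ 2 / 32) ?_ hz
  have : min (γ ^ 2) T / 2 ≤ min (γ ^ 2) (T / 2) :=
    le_min (by linarith [min_le_left (γ ^ 2) T, sq_nonneg γ]) (by linarith [min_le_right (γ ^ 2) T])
  rw [hδsq]
  linarith
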